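/- Let $n\ge 0$. By a Morse function on $(\mathbb C^n,0)$ we mean a germ of holomorphic function $f:(\mathbb C^n,0)\to(\mathbb C,0)$ (so $f(0)=0$) with $df(0)=0$ and nondegenerate Hessian at $0$; $q_f$ denotes its quadratic part (the degree-two homogeneous part of its Taylor series at $0$). A pair $(f,g)$ of Morse functions is called $\mathscr R$-generic if there are linear coordinates $(x_1,\dots,x_n)$ on $\mathbb C^n$ in which $q_f=\sum_{i=1}^n x_i^2$ and $q_g=\sum_{i=1}^n\lambda_i x_i^2$ with $\lambda_i\ne\lambda_j$ for $i\ne j$. A diffeomorphism of $(\mathbb C^n,0)$ is a germ of biholomorphism fixing $0$. **Theorem.** Let $f,g_0,g_1$ be Morse functions on $(\mathbb C^n,0)$ such that $(f,g_0)$ and $(f,g_1)$ are $\mathscr R$-generic and $g_0,g_1$ have the same $2$-jet at $0$, $j^2g_0=j^2g_1$. Then there is a diffeomorphism $\varphi$ of $(\mathbb C^n,0)$ such that $f\circ\varphi=f$ (as germs at $0$), and $g_0\circ\varphi=g_1$ in restriction to the germ at $0$ of $\{f=0\}$. **Corollary.** Let $f$ and $g$ be Morse functions on $(\mathbb C^n,0)$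 such that $(f,g)$ is $\mathscr R$-generic. Then $g$ restricted to $\{f=0\}$ is diffeomorphic to a quadratic function: there are a diffeomorphism $\psi$ of $(\mathbb C^n,0)$ and $\lambda_1,\dots,\lambda_{n-1}\in\mathbb C$ such that $f\circ\psi=\sum_{i=1}^n x_i^2$ near $0$ and $$g\circ\psi=\sum_{i=1}^{n-1}\lambda_i x_i^2\quad\text{in restriction to the germ at }0\text{ of }\Big\{\sum_{i=1}^n x_i^2=0\Big\}.$$ -/

import Mathlib

open Filter Topology

/-- `φ` represents the germ of a biholomorphism of `(ℂⁿ, 0)`: it is holomorphic near `0`, fixes `0`,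
and has a two-sided inverse germ with the same properties. -/
def IsDiffeoGerm {n : ℕ} (φ : (Fin n → ℂ) → (Fin n → ℂ)) : Prop :=
  AnalyticAt ℂ φ 0 ∧ φ 0 = 0 ∧
    ∃ ψ : (Fin n → ℂ) → (Fin n → ℂ), AnalyticAt ℂ ψ 0 ∧ ψ 0 = 0 ∧
      (∀ᶠ x in 𝓝 0, ψ (φ x) = x) ∧ (∀ᶠ x in 𝓝 0, φ (ψ x) = x)

/-- `f` represents a germ `(ℂⁿ, 0) → (ℂ, 0)` of a Morse function: it is holomorphic near `0`,
vanishes at `0`, and `0` is a critical point at which the Hessian form is nondegenerate. -/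
structure IsMorse {n : ℕ} (f : (Fin n → ℂ) → ℂ) : Prop where
  analyticAt : AnalyticAt ℂ f 0
  map_zero : f 0 = 0
  critical : fderiv ℂ f 0 = 0
  nondegenerate : ∀ v, (∀ w, iteratedFDeriv ℂ 2 f 0 ![v, w] = 0) → v = 0

/-- The quadratic part `q_f` of `f` at `0`: the homogeneous part of degree two of its
Taylor series. -/
noncomputable def quadraticPart {n : ℕ} (f : (Fin n → ℂ) → ℂ) (x : Fin n → ℂ) : ℂ :=
  (1 / 2 : ℂ) * iteratedFDeriv ℂ 2 f 0 ![x, x]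

/-- In suitable linear coordinates the quadratic parts are `q_f = ∑ xᵢ²` and `q_g = ∑ λᵢ xᵢ²`
with pairwise distinct `λᵢ`. -/
def IsRGeneric {n : ℕ} (f g : (Fin n → ℂ) → ℂ) : Prop :=
  ∃ (L : (Fin n → ℂ) ≃ₗ[ℂ] (Fin n → ℂ)) (lam : Fin n → ℂ), Function.Injective lam ∧
    (∀ x, quadraticPart f (L x) = ∑ i, x i ^ 2) ∧
    (∀ x, quadraticPart g (L x) = ∑ i, lam i * x i ^ 2)

/-- Equality `j^k g₀ = j^k g₁` of the `k`-jets at `0`. -/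
def SameJet {n : ℕ} (k : ℕ) (g₀ g₁ : (Fin n → ℂ) → ℂ) : Prop :=
  ∀ m ≤ k, iteratedFDeriv ℂ m g₀ 0 = iteratedFDeriv ℂ m g₁ 0

/-! In Morse coordinates for `f` tangent to `L`, `f` becomes `∑ xᵢ²`, and any germ with the
prescribed quadratic part becomes `∑ λᵢ xᵢ²` plus a cubic form with analytic coefficients.

The diffeomorphism is built directly, with no flow to integrate. If `S z` is antisymmetric, then `z
+ S z • z` and `z - S z • z` have the same sum of squares, so the map `φ` sending the second to the
first (a Cayley transform) preserves `∑ xᵢ²`. In the comparison of `G₀ (φ x)` with `G₁ x`, the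
quadratic parts contribute exactly `4 ∑ λᵢ zᵢ (S z)ᵢ`. For `S` linear in `z` with free coefficients,
this reaches every monomial `zᵢ zⱼ zₖ` with `i ≠ j`, because `λᵢ ≠ λⱼ`. The missing cubes `zᵢ³` are
recovered modulo the sum of squares. Thus `S` can cancel the cubic difference on the cone. Since
that difference depends on `S`, this is a fixed point equation. At `z = 0` its right side is
constant in the unknown coefficients, so the implicit function theorem solves it.

The corollary compares `g` with its own quadratic part, then uses the equation of the cone to
eliminate the last square. -/

open scoped ContDiff

/-! ### Hadamard division, analytic implicit and inverse functions -/

/-- Hadamard's lemma for power series: dividing by the last variable shifts the series. -/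
theorem HasFPowerSeriesAt.exists_shift {E F : Type*} [NormedAddCommGroup E] [NormedSpace ℂ E]
    [NormedAddCommGroup F] [NormedSpace ℂ F] [CompleteSpace F] {f : E → F}
    {p : FormalMultilinearSeries ℂ E F} (hf : HasFPowerSeriesAt f p 0) :
    ∃ q : E → E →L[ℂ] F, HasFPowerSeriesAt q p.shift 0 ∧ q 0 = fderiv ℂ f 0 ∧
      ∀ᶠ x in 𝓝 0, f x = f 0 + q x x := by
  have hfd := hf.fderiv_eq
  obtain ⟨r, hr⟩ := hf
  have hpos : 0 < p.shift.radius := by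
    rw [FormalMultilinearSeries.radius_shift]
    exact hr.r_pos.trans_le hr.r_le
  have hq := p.shift.hasFPowerSeriesOnBall hpos
  refine ⟨p.shift.sum, hq.hasFPowerSeriesAt, ?_, ?_⟩
  · rw [hfd, ← hq.hasFPowerSeriesAt.coeff_zero ![]]
    ext v
    simp only [FormalMultilinearSeries.shift, ContinuousMultilinearMap.curryRight_apply]
    simp
  filter_upwards [Metric.eball_mem_nhds (0 : E) hr.r_pos] with x hx
  have h1 := hr.hasSum hx
  have hx' : x ∈ Metric.eball (0 : E) p.shift.radius := by
    rw [FormalMultilinearSeries.radius_shift]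
    exact Metric.eball_subset_eball hr.r_le hx
  have h2 := (ContinuousLinearMap.apply ℂ F x).hasSum (hq.hasSum hx')
  simp only [zero_add] at h1 h2
  have h3 : HasSum (fun k ↦ p (k + 1) fun _ ↦ x) (p.shift.sum x x) := by
    convert! h2 using 2 with k
    simp only [FormalMultilinearSeries.shift, ContinuousLinearMap.apply_apply,
      ContinuousMultilinearMap.curryRight_apply]
    congr 1
    ext i
    refine Fin.lastCases ?_ (fun j ↦ ?_) i <;> simp
  have h4 := (hasSum_nat_add_iff (f := fun k ↦ p k fun _ ↦ x) 1).1 h3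
  rw [Finset.sum_range_one, hr.coeff_zero] at h4
  rw [h1.unique h4, add_comm]

/-- Hadamard's lemma for germs of analytic functions. -/
theorem ContDiffAt.exists_hadamard {E F : Type*} [NormedAddCommGroup E] [NormedSpace ℂ E]
    [NormedAddCommGroup F] [NormedSpace ℂ F] [CompleteSpace E] [CompleteSpace F] {f : E → F}
    (hf : ContDiffAt ℂ ω f 0) :
    ∃ q : E → E →L[ℂ] F, ContDiffAt ℂ ω q 0 ∧ q 0 = fderiv ℂ f 0 ∧
      ∀ᶠ x in 𝓝 0, f x = f 0 + q x x := by
  obtain ⟨p, hp⟩ := hf.analyticAt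
  obtain ⟨q, hq, hq0, h⟩ := hp.exists_shift
  exact ⟨q, hq.analyticAt.contDiffAt, hq0, h⟩

/-- A critical germ is a quadratic form with analytic coefficients, equal to its quadratic part
at the origin. -/
theorem AnalyticAt.exists_eq_bilinear {n : ℕ} {f : (Fin n → ℂ) → ℂ} (hf : AnalyticAt ℂ f 0)
    (h0 : f 0 = 0) (h1 : fderiv ℂ f 0 = 0) :
    ∃ B : (Fin n → ℂ) → (Fin n → ℂ) →L[ℂ] (Fin n → ℂ) →L[ℂ] ℂ, ContDiffAt ℂ ω B 0 ∧
      (∀ᶠ x in 𝓝 0, f x = B x x x) ∧ ∀ v, B 0 v v = quadraticPart f v := by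
  obtain ⟨p, r, hr⟩ := hf
  obtain ⟨q, hq, hq0, h⟩ := hr.hasFPowerSeriesAt.exists_shift
  obtain ⟨B, hB, -, h'⟩ := hq.exists_shift
  refine ⟨B, hB.analyticAt.contDiffAt, ?_, fun v ↦ ?_⟩
  · filter_upwards [h, h'] with x hx hx'
    rw [hx, h0, hx', hq0, h1, zero_add, zero_add]
  · rw [← hB.coeff_zero ![]]
    simp only [FormalMultilinearSeries.shift, ContinuousMultilinearMap.curryRight_apply]
    -- `B 0 v v` is `p 2` on `(v, v)`, and `2! • p 2` is the second derivative there: this is the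
    -- factor `1 / 2` in `quadraticPart`.
    have h3 := hr.factorial_smul v 2
    have h4 : (![v, v] : Fin 2 → Fin n → ℂ) = fun _ ↦ v := by
      ext i; fin_cases i <;> rfl
    rw [quadraticPart, h4, ← h3]
    simp only [Nat.factorial, nsmul_eq_mul]
    push_cast
    ring_nf
    congr 1
    ext i
    fin_cases i <;> rfl

/-- Solvability of an analytic fixed point equation `a = Ψ (x, a)` by the implicit function
theorem. -/
theorem ContDiffAt.exists_fixedPoint {E V : Type*} [NormedAddCommGroup E] [NormedSpace ℂ E]
    [NormedAddCommGroup V] [NormedSpace ℂ V] [CompleteSpace E] [CompleteSpace V]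
    {Ψ : E × V → V} {a₀ : V} (hΨ : ContDiffAt ℂ ω Ψ (0, a₀)) (h0 : Ψ (0, a₀) = a₀)
    (hd : HasFDerivAt (fun a ↦ Ψ (0, a)) (0 : V →L[ℂ] V) a₀) :
    ∃ a : E → V, ContDiffAt ℂ ω a 0 ∧ a 0 = a₀ ∧ ∀ᶠ x in 𝓝 0, a x = Ψ (x, a x) := by
  have hG : ContDiffAt ℂ ω (fun u : E × V ↦ u.2 - Ψ u) (0, a₀) := contDiffAt_snd.sub hΨ
  have hω : (ω : WithTop ℕ∞) ≠ 0 := by simp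
  have hid : fderiv ℂ (fun u : E × V ↦ u.2 - Ψ u) (0, a₀) ∘L .inr ℂ E V = .id ℂ V := by
    have h1 : HasFDerivAt (fun a : V ↦ ((0 : E), a)) (.inr ℂ E V) a₀ := hasFDerivAt_prodMk_right _ _
    have h2 := (hG.differentiableAt hω).hasFDerivAt.comp a₀ h1
    have h3 := (hasFDerivAt_id (𝕜 := ℂ) a₀).sub hd
    rw [sub_zero] at h3
    exact h2.unique h3
  have hinv : (fderiv ℂ (fun u : E × V ↦ u.2 - Ψ u) (0, a₀) ∘L .inr ℂ E V).IsInvertible := by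
    rw [hid]
    exact ⟨.refl ℂ V, rfl⟩
  refine ⟨hG.implicitFunction hω hinv, hG.contDiffAt_implicitFunction hω hinv,
    hG.implicitFunction_apply_self hω hinv, ?_⟩
  filter_upwards [hG.eventually_apply_implicitFunction hω hinv] with x hx
  simpa [h0, sub_eq_zero] using hx

/-- The inverse function theorem for analytic germs tangent to the identity. -/
theorem ContDiffAt.exists_inverse {E : Type*} [NormedAddCommGroup E] [NormedSpace ℂ E]
    [CompleteSpace E] {u : E → E} (hu : ContDiffAt ℂ ω u 0) (h0 : u 0 = 0)
    (hd : HasFDerivAt u (.id ℂ E) 0) :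
    ∃ v : E → E, ContDiffAt ℂ ω v 0 ∧ v 0 = 0 ∧ HasFDerivAt v (.id ℂ E) 0 ∧
      (∀ᶠ x in 𝓝 0, v (u x) = x) ∧ ∀ᶠ x in 𝓝 0, u (v x) = x := by
  have hω : (ω : WithTop ℕ∞) ≠ 0 := by simp
  have hd' : HasFDerivAt u ((ContinuousLinearEquiv.refl ℂ E : E ≃L[ℂ] E) : E →L[ℂ] E) 0 := hd
  have hs := hu.hasStrictFDerivAt' hd' hω
  have h1 := hu.to_localInverse hd' hω
  have h2 := hs.to_localInverse
  have h3 := hs.localInverse_apply_image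
  have h4 := hs.eventually_right_inverse
  rw [h0] at h1 h2 h3 h4
  exact ⟨_, h1, h3, h2.hasFDerivAt, hs.eventually_left_inverse, h4⟩

/-! ### Germs of diffeomorphisms -/

theorem IsDiffeoGerm.comp {n : ℕ} {φ ψ : (Fin n → ℂ) → (Fin n → ℂ)} (hφ : IsDiffeoGerm φ)
    (hψ : IsDiffeoGerm ψ) : IsDiffeoGerm (φ ∘ ψ) := by
  obtain ⟨a1, z1, φ', a1', z1', l1, r1⟩ := hφ
  obtain ⟨a2, z2, ψ', a2', z2', l2, r2⟩ := hψ
  refine ⟨AnalyticAt.comp (by rwa [z2]) a2, by simp [z1, z2], ψ' ∘ φ',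
    AnalyticAt.comp (by rwa [z1']) a1', by simp [z1', z2'], ?_, ?_⟩
  · have := a2.continuousAt.tendsto
    rw [z2] at this
    filter_upwards [l2, this.eventually l1] with x h1 h2
    simp [h1, h2]
  · have := a1'.continuousAt.tendsto
    rw [z1'] at this
    filter_upwards [r1, this.eventually r2] with x h1 h2
    simp [h1, h2]

theorem IsDiffeoGerm.tendsto {n : ℕ} {φ : (Fin n → ℂ) → (Fin n → ℂ)} (hφ : IsDiffeoGerm φ) :
    Tendsto φ (𝓝 0) (𝓝 0) := by
  simpa [hφ.2.1] using hφ.1.continuousAt.tendsto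

theorem IsDiffeoGerm.exists_symm {n : ℕ} {φ : (Fin n → ℂ) → (Fin n → ℂ)} (hφ : IsDiffeoGerm φ) :
    ∃ ψ, IsDiffeoGerm ψ ∧ (∀ᶠ x in 𝓝 0, ψ (φ x) = x) ∧ ∀ᶠ x in 𝓝 0, φ (ψ x) = x := by
  obtain ⟨a1, z1, φ', a1', z1', l1, r1⟩ := hφ
  exact ⟨φ', ⟨a1', z1', φ, a1, z1, r1, l1⟩, l1, r1⟩

theorem LinearEquiv.isDiffeoGerm {n : ℕ} (L : (Fin n → ℂ) ≃ₗ[ℂ] (Fin n → ℂ)) :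
    IsDiffeoGerm L :=
  ⟨L.toContinuousLinearEquiv.analyticAt 0, map_zero L, L.symm,
    L.symm.toContinuousLinearEquiv.analyticAt 0, map_zero L.symm, by simp, by simp⟩

/-- The map `x ↦ x + S x • x`, for a germ of matrix valued functions `S` with `S 0 = 0`, is a
diffeomorphism tangent to the identity. -/
theorem ContDiffAt.isDiffeoGerm_add_mul {n : ℕ} {S : (Fin n → ℂ) → Fin n → Fin n → ℂ}
    (hS : ContDiffAt ℂ ω S 0) (h0 : S 0 = 0) :
    ∃ v, IsDiffeoGerm v ∧ HasFDerivAt v (.id ℂ (Fin n → ℂ)) 0 ∧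
      (∀ᶠ x in 𝓝 0, v (fun i ↦ x i + ∑ j, S x i j * x j) = x) ∧
      ∀ᶠ x in 𝓝 0, (fun i ↦ v x i + ∑ j, S (v x) i j * v x j) = x := by
  have hS' : ∀ i j, ContDiffAt ℂ ω (fun x ↦ S x i j) 0 := fun i j ↦
    contDiffAt_pi.1 (contDiffAt_pi.1 hS i) j
  have hu : ContDiffAt ℂ ω (fun x : Fin n → ℂ ↦ fun i ↦ x i + ∑ j, S x i j * x j) 0 := by
    refine contDiffAt_pi.2 fun i ↦ ?_
    refine ContDiffAt.add (by fun_prop) (ContDiffAt.sum fun j _ ↦ (hS' i j).mul (by fun_prop))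
  have hu0 : (fun i ↦ (0 : Fin n → ℂ) i + ∑ j, S 0 i j * (0 : Fin n → ℂ) j) = 0 := by
    ext i; simp
  obtain ⟨v, hv, hv0, hvd, h1, h2⟩ := hu.exists_inverse hu0 (by
    refine hasFDerivAt_pi'.2 fun i ↦ ?_
    have h1 : ∀ j ∈ Finset.univ, HasFDerivAt (fun x : Fin n → ℂ ↦ S x i j * x j)
        (0 : (Fin n → ℂ) →L[ℂ] ℂ) 0 := fun j _ ↦ by
      have := ((hS' i j).differentiableAt (by simp)).hasFDerivAt.mul
        (hasFDerivAt_apply (𝕜 := ℂ) j (0 : Fin n → ℂ))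
      convert! this using 1
      ext v
      simp [h0]
    have h2 := (hasFDerivAt_apply (𝕜 := ℂ) i (0 : Fin n → ℂ)).add (HasFDerivAt.fun_sum h1)
    convert! h2 using 1
    ext; simp)
  refine ⟨v, ⟨hv.analyticAt, hv0, _, hu.analyticAt, hu0, h2, h1⟩, hvd, h1, h2⟩

/-! ### The holomorphic Morse lemma -/

theorem HasFDerivAt.eq_zero_of_even {E F : Type*} [NormedAddCommGroup E] [NormedSpace ℂ E]
    [NormedAddCommGroup F] [NormedSpace ℂ F] {f : E → F} {f' : E →L[ℂ] F}
    (hf : HasFDerivAt f f' 0) (he : ∀ x, f (-x) = f x) : f' = 0 := by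
  have h1 : HasFDerivAt (fun x : E ↦ -x) (-.id ℂ E) 0 := (hasFDerivAt_id 0).neg
  have h2 : HasFDerivAt (f ∘ fun x ↦ -x) (f' ∘L (-.id ℂ E)) 0 :=
    HasFDerivAt.comp 0 (by rwa [neg_zero]) h1
  have h3 : f ∘ (fun x ↦ -x) = f := funext he
  rw [h3] at h2
  have h4 := hf.unique h2
  ext v
  have h5 := congrArg (fun l ↦ l v) h4
  have h6 : f' v = -f' v := by simpa using h5
  have h7 : (2 : ℂ) • f' v = 0 := by
    rw [two_smul]
    nth_rw 2 [h6]
    exact add_neg_cancel _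
  simpa using h7

theorem Pi.eq_sum_smul_single {n : ℕ} (x : Fin n → ℂ) :
    x = ∑ i, x i • (Pi.single i (1 : ℂ) : Fin n → ℂ) := by
  ext j
  simp [Finset.sum_apply, Pi.single_apply]

theorem ContinuousLinearMap.apply_apply_eq_sum {n : ℕ} {E : Type*} [NormedAddCommGroup E]
    [NormedSpace ℂ E] (b : E →L[ℂ] E →L[ℂ] ℂ) {x : Fin n → ℂ} {e : Fin n → E} {y : E}
    (hy : y = ∑ i, x i • e i) :
    b y y = ∑ i, ∑ j, b (e i) (e j) * (x i * x j) := by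
  rw [hy]
  simp only [map_sum, map_smul, _root_.sum_apply, _root_.smul_apply, smul_eq_mul, Finset.mul_sum]
  rw [Finset.sum_comm]
  exact Finset.sum_congr rfl fun i _ ↦ Finset.sum_congr rfl fun j _ ↦ by ring

theorem ContDiffAt.comp_clm_apply_apply {X E : Type*} [NormedAddCommGroup X] [NormedSpace ℂ X]
    [NormedAddCommGroup E] [NormedSpace ℂ E] {B : E → E →L[ℂ] E →L[ℂ] ℂ} {x : X} {y : E}
    {k : WithTop ℕ∞} (hB : ContDiffAt ℂ k B y) {ψ u v : X → E} (hψ : ContDiffAt ℂ k ψ x)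
    (hψx : ψ x = y) (hu : ContDiffAt ℂ k u x) (hv : ContDiffAt ℂ k v x) :
    ContDiffAt ℂ k (fun z ↦ B (ψ z) (u z) (v z)) x := by
  subst hψx
  have h : ContDiffAt ℂ k (fun z ↦ B (ψ z)) x := hB.comp x hψ
  exact (h.clm_apply hu).clm_apply hv

/-- The holomorphic Morse lemma, with prescribed derivative at the critical point. -/
theorem IsMorse.exists_morse_coordinates {n : ℕ} {f : (Fin n → ℂ) → ℂ} (hf : IsMorse f)
    (L : (Fin n → ℂ) ≃ₗ[ℂ] (Fin n → ℂ)) (hL : ∀ x, quadraticPart f (L x) = ∑ i, x i ^ 2) :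
    ∃ ψ, IsDiffeoGerm ψ ∧
      HasFDerivAt ψ (L.toContinuousLinearEquiv : (Fin n → ℂ) →L[ℂ] (Fin n → ℂ)) 0 ∧
      ∀ᶠ x in 𝓝 0, f (ψ x) = ∑ i, x i ^ 2 := by
  obtain ⟨B, hB, hfB, hBq⟩ := hf.analyticAt.exists_eq_bilinear hf.map_zero hf.critical
  set e : Fin n → Fin n → ℂ := fun i ↦ L (Pi.single i 1) with he
  set Λ : (Fin n → ℂ) →L[ℂ] (Fin n → ℂ) := (L.toContinuousLinearEquiv : (Fin n → ℂ) →L[ℂ] (Fin n → ℂ))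
  have hLe : ∀ x, L x = ∑ i, x i • e i := fun x ↦ by
    conv_lhs => rw [Pi.eq_sum_smul_single x]
    simp [he]
  -- Symmetrized, since `H` is to be factored as `(1 + S)ᵀ (1 + S)`, which is symmetric.
  let H : (Fin n → ℂ) → Fin n → Fin n → ℂ := fun x i j ↦
    (B (Λ x) (e i) (e j) + B (Λ x) (e j) (e i)) / 2
  have hBe : ∀ i j, ContDiffAt ℂ ω (fun x ↦ B (Λ x) (e i) (e j)) 0 := fun i j ↦
    hB.comp_clm_apply_apply Λ.contDiff.contDiffAt (_root_.map_zero Λ) contDiffAt_const contDiffAt_const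
  have hH : ∀ i j, ContDiffAt ℂ ω (fun x ↦ H x i j) 0 := fun i j ↦
    ((hBe i j).add (hBe j i)).div_const 2
  have hBx : ∀ b : (Fin n → ℂ) →L[ℂ] (Fin n → ℂ) →L[ℂ] ℂ, ∀ x : Fin n → ℂ,
      b (L x) (L x) = ∑ i, ∑ j, (b (e i) (e j) + b (e j) (e i)) / 2 * (x i * x j) := by
    intro b x
    have h1 : b (L x) (L x) = ∑ i, ∑ j, b (e i) (e j) * (x i * x j) :=
      b.apply_apply_eq_sum (hLe x)
    have h2 : b (L x) (L x) = ∑ i, ∑ j, b (e j) (e i) * (x i * x j) := by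
      rw [h1, Finset.sum_comm]
      exact Finset.sum_congr rfl fun i _ ↦ Finset.sum_congr rfl fun j _ ↦ by ring
    have h3 : b (L x) (L x) = (b (L x) (L x) + b (L x) (L x)) / 2 := by ring
    rw [h3]
    nth_rw 1 [h1]
    rw [h2, ← Finset.sum_add_distrib, Finset.sum_div]
    refine Finset.sum_congr rfl fun i _ ↦ ?_
    rw [← Finset.sum_add_distrib, Finset.sum_div]
    exact Finset.sum_congr rfl fun j _ ↦ by ring
  have hH0 : ∀ i j, H 0 i j = if i = j then 1 else 0 := by
    -- Only the diagonal values of `B 0` are known; polarization gives its symmetric part.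
    have hpol : ∀ x y : Fin n → ℂ, B 0 (L x) (L y) + B 0 (L y) (L x) = 2 * ∑ i, x i * y i := by
      intro x y
      have h1 := hBq (L (x + y))
      have h2 := hBq (L x)
      have h3 := hBq (L y)
      rw [hL] at h1 h2 h3
      simp only [map_add, _root_.add_apply, Pi.add_apply] at h1
      have h4 : ∑ i, (x i + y i) ^ 2 = ∑ i, x i ^ 2 + ∑ i, y i ^ 2 + 2 * ∑ i, x i * y i := by
        rw [Finset.mul_sum, ← Finset.sum_add_distrib, ← Finset.sum_add_distrib]
        exact Finset.sum_congr rfl fun i _ ↦ by ring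
      rw [h4] at h1
      linear_combination h1 - h2 - h3
    intro i j
    have h1 := hpol (Pi.single i 1) (Pi.single j 1)
    change (B (Λ 0) (e i) (e j) + B (Λ 0) (e j) (e i)) / 2 = _
    rw [_root_.map_zero, he, h1]
    rcases eq_or_ne i j with rfl | hij
    · simp [Pi.single_apply]
    · simp [Pi.single_apply, hij, hij.symm]
  -- The equation `H = (1 + S)ᵀ (1 + S)` rewritten with the linear term replaced by `2 S`. At `x =
  -- 0`, `H` is the identity, so `Ψ (0, S) = -SᵀS / 2` is even in `S` and has zero derivative.
  let Ψ : (Fin n → ℂ) × (Fin n → Fin n → ℂ) → Fin n → Fin n → ℂ := fun u i j ↦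
    (H u.1 i j - (if i = j then 1 else 0) - ∑ k, u.2 k i * u.2 k j) / 2
  have hΨ : ContDiffAt ℂ ω Ψ (0, 0) := by
    refine contDiffAt_pi.2 fun i ↦ contDiffAt_pi.2 fun j ↦ ?_
    have h1 : ContDiffAt ℂ ω (fun u : (Fin n → ℂ) × (Fin n → Fin n → ℂ) ↦ H u.1 i j) (0, 0) :=
      ContDiffAt.comp (0, 0) (hH i j) contDiffAt_fst
    simp only [Ψ]
    fun_prop
  have hΨ0 : Ψ (0, 0) = 0 := by
    ext i j
    simp [Ψ, hH0]
  have hd : HasFDerivAt (fun S ↦ Ψ (0, S)) (0 : (Fin n → Fin n → ℂ) →L[ℂ] _) 0 := by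
    have h1 : DifferentiableAt ℂ (fun S ↦ Ψ (0, S)) 0 :=
      (hΨ.differentiableAt (by simp)).comp (0 : Fin n → Fin n → ℂ)
        (hasFDerivAt_prodMk_right (𝕜 := ℂ) _ _).differentiableAt
    have h2 := h1.hasFDerivAt
    rwa [h2.eq_zero_of_even fun S ↦ by simp [Ψ]] at h2
  obtain ⟨S, hS, hS0, hSΨ⟩ := hΨ.exists_fixedPoint hΨ0 hd
  obtain ⟨v, hv, hvd, -, hv2⟩ := hS.isDiffeoGerm_add_mul hS0
  refine ⟨L ∘ v, L.isDiffeoGerm.comp hv, ?_, ?_⟩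
  · exact Λ.hasFDerivAt.comp 0 hvd
  · have hΛt : Tendsto Λ (𝓝 0) (𝓝 0) := by simpa using Λ.continuous.tendsto 0
    filter_upwards [hv2, hv.tendsto.eventually hSΨ, (hΛt.comp hv.tendsto).eventually hfB]
      with y hy hy1 hy2
    have key : ∀ i j, H (v y) i j =
        2 * S (v y) i j + (if i = j then 1 else 0) + ∑ k, S (v y) k i * S (v y) k j := by
      intro i j
      have := congrFun (congrFun hy1 i) j
      simp only [Ψ] at this
      rw [this]
      ring
    have hy2' : f (L (v y)) = B (L (v y)) (L (v y)) (L (v y)) := hy2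
    rw [Function.comp_apply, hy2', hBx]
    have h5 : ∀ i j, (B (L (v y)) (e i) (e j) + B (L (v y)) (e j) (e i)) / 2 = H (v y) i j :=
      fun i j ↦ rfl
    simp only [h5, key]
    conv_rhs => rw [← hy]
    generalize v y = x
    generalize S x = T
    have h6 : ∑ i, (x i + ∑ j, T i j * x j) ^ 2 = ∑ i, x i ^ 2 +
        2 * ∑ i, ∑ j, T i j * (x i * x j) + ∑ i, (∑ j, T i j * x j) * ∑ k, T i k * x k := by
      rw [Finset.mul_sum, ← Finset.sum_add_distrib, ← Finset.sum_add_distrib]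
      refine Finset.sum_congr rfl fun i _ ↦ ?_
      have : ∑ j, T i j * (x i * x j) = x i * ∑ j, T i j * x j := by
        rw [Finset.mul_sum]
        exact Finset.sum_congr rfl fun j _ ↦ by ring
      rw [this]
      ring
    have h7 : ∑ i, ∑ j, (∑ k, T k i * T k j) * (x i * x j) =
        ∑ i, (∑ j, T i j * x j) * ∑ k, T i k * x k := by
      have h8 : ∀ k, (∑ j, T k j * x j) * ∑ j, T k j * x j =
          ∑ i, ∑ j, T k i * T k j * (x i * x j) := fun k ↦ by
        rw [Finset.sum_mul_sum]
        exact Finset.sum_congr rfl fun i _ ↦ Finset.sum_congr rfl fun j _ ↦ by ring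
      simp only [h8, Finset.sum_mul]
      rw [Finset.sum_comm_cycle]
    rw [h6, ← h7]
    simp only [add_mul, Finset.sum_add_distrib, ite_mul, one_mul, zero_mul, Finset.sum_ite_eq,
      Finset.mem_univ, if_true, Finset.mul_sum, mul_assoc, sq]
    ring

/-! ### Quadratic part and cubic remainder in new coordinates -/

/-- The Taylor expansion to second order of a critical germ composed with a germ of map. -/
theorem IsMorse.exists_comp_eq_quadraticPart_add_cubic {n : ℕ} {g : (Fin n → ℂ) → ℂ}
    (hg : IsMorse g) {ψ : (Fin n → ℂ) → (Fin n → ℂ)} (hψ : AnalyticAt ℂ ψ 0) (hψ0 : ψ 0 = 0)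
    {Λ : (Fin n → ℂ) →L[ℂ] (Fin n → ℂ)} (hΛ : HasFDerivAt ψ Λ 0) :
    ∃ c : Fin n → Fin n → Fin n → (Fin n → ℂ) → ℂ, (∀ i j k, ContDiffAt ℂ ω (c i j k) 0) ∧
      ∀ᶠ x in 𝓝 0, g (ψ x) =
        quadraticPart g (Λ x) + ∑ i, ∑ j, ∑ k, c i j k x * (x i * x j * x k) := by
  obtain ⟨B, hB, hgB, hBq⟩ := hg.analyticAt.exists_eq_bilinear hg.map_zero hg.critical
  obtain ⟨M, hM, hM0, hψM⟩ := hψ.contDiffAt.exists_hadamard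
  rw [hΛ.fderiv] at hM0
  have hMe : ∀ i, ContDiffAt ℂ ω (fun x ↦ M x (Pi.single i (1 : ℂ))) 0 := fun i ↦
    hM.clm_apply contDiffAt_const
  have hβ : ∀ i j, ContDiffAt ℂ ω (fun x ↦ B (ψ x) (M x (Pi.single i (1 : ℂ)))
      (M x (Pi.single j (1 : ℂ)))) 0 := fun i j ↦
    hB.comp_clm_apply_apply hψ.contDiffAt hψ0 (hMe i) (hMe j)
  -- With `ψ x = M x x`, `g ∘ ψ` is a quadratic form in `x` with analytic coefficients. Their values
  -- at `0` give `quadraticPart g ∘ Λ`; dividing the remainders once more gives the cubic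
  -- coefficients.
  choose γ hγ _ hβγ using fun i j ↦ (hβ i j).exists_hadamard
  refine ⟨fun i j k x ↦ γ i j x (Pi.single k 1), fun i j k ↦ (hγ i j).clm_apply contDiffAt_const,
    ?_⟩
  have ht : Tendsto ψ (𝓝 0) (𝓝 0) := by simpa [hψ0] using hψ.continuousAt.tendsto
  filter_upwards [ht.eventually hgB, hψM, eventually_all.2 fun i ↦ eventually_all.2 (hβγ i)]
    with x h1 h2 h3
  rw [hψ0, zero_add] at h2
  have hexp : ∀ (l : (Fin n → ℂ) →L[ℂ] (Fin n → ℂ)) (b : (Fin n → ℂ) →L[ℂ] (Fin n → ℂ) →L[ℂ] ℂ),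
      b (l x) (l x) =
        ∑ i, ∑ j, b (l (Pi.single i (1 : ℂ))) (l (Pi.single j (1 : ℂ))) * (x i * x j) := by
    intro l b
    have hl : l x = ∑ i, x i • l (Pi.single i (1 : ℂ)) := by
      conv_lhs => rw [Pi.eq_sum_smul_single x]
      simp
    exact b.apply_apply_eq_sum hl
  have hk : ∀ i j, γ i j x x = ∑ k, γ i j x (Pi.single k 1) * x k := fun i j ↦ by
    conv_lhs => rw [Pi.eq_sum_smul_single x, map_sum]
    rw [← Pi.eq_sum_smul_single x]
    simp [mul_comm]
  have h4 : B (ψ x) (ψ x) (ψ x) = B (ψ x) (M x x) (M x x) := by rw [← h2]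
  rw [h1, h4, hexp, ← hBq, hexp, ← Finset.sum_add_distrib]
  refine Finset.sum_congr rfl fun i _ ↦ ?_
  rw [← Finset.sum_add_distrib]
  refine Finset.sum_congr rfl fun j _ ↦ ?_
  rw [h3 i j, hψ0, hM0, add_mul, hk, Finset.sum_mul]
  exact congrArg _ (Finset.sum_congr rfl fun k _ ↦ by ring)

/-! ### Antisymmetric matrices and cubic forms modulo the sum of squares -/

theorem sum_mul_sum_mul_eq_zero_of_antisymm {n : ℕ} {S : Fin n → Fin n → ℂ}
    (hS : ∀ i j, S i j = -S j i) (z : Fin n → ℂ) : ∑ i, z i * ∑ j, S i j * z j = 0 := by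
  have h1 : ∑ i, z i * ∑ j, S i j * z j = ∑ i, ∑ j, S i j * z i * z j := by
    simp only [Finset.mul_sum]
    exact Finset.sum_congr rfl fun i _ ↦ Finset.sum_congr rfl fun j _ ↦ by ring
  have h2 : ∑ i, ∑ j, S i j * z i * z j = -∑ i, ∑ j, S i j * z i * z j := by
    conv_lhs => rw [Finset.sum_comm]
    simp only [← Finset.sum_neg_distrib]
    exact Finset.sum_congr rfl fun i _ ↦ Finset.sum_congr rfl fun j _ ↦ by rw [hS j i]; ring
  rw [h1]
  linear_combination h2 / 2

/-- The cross term `zᵀSz` vanishes. What remains is even in `S`, so `z + S z` and `z - S z` lie on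
the same level of the sum of squares. -/
theorem sum_sq_add_antisymm {n : ℕ} {S : Fin n → Fin n → ℂ}
    (hS : ∀ i j, S i j = -S j i) (z : Fin n → ℂ) :
    ∑ i, (z i + ∑ j, S i j * z j) ^ 2 =
      ∑ i, z i ^ 2 + ∑ i, ∑ j, (∑ k, S k i * S k j) * (z i * z j) := by
  have h1 : ∑ i, ∑ j, (∑ k, S k i * S k j) * (z i * z j) = ∑ k, (∑ j, S k j * z j) ^ 2 := by
    have h2 : ∀ k, (∑ j, S k j * z j) ^ 2 = ∑ i, ∑ j, S k i * S k j * (z i * z j) := fun k ↦ by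
      rw [sq, Finset.sum_mul_sum]
      exact Finset.sum_congr rfl fun i _ ↦ Finset.sum_congr rfl fun j _ ↦ by ring
    simp only [h2, Finset.sum_mul]
    rw [Finset.sum_comm_cycle]
  have h3 := sum_mul_sum_mul_eq_zero_of_antisymm hS z
  simp only [h1, add_sq, Finset.sum_add_distrib, mul_assoc, ← Finset.mul_sum, h3]
  ring

/-- Substitution of a linear combination in a cubic form. -/
theorem sum_cubic_substitution {n : ℕ} (C : Fin n → Fin n → Fin n → ℂ) (P : Fin n → Fin n → ℂ)
    (z : Fin n → ℂ) :
    ∑ i, ∑ j, ∑ k, C i j k * ((∑ l, P i l * z l) * (∑ m, P j m * z m) * ∑ r, P k r * z r) =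
      ∑ l, ∑ m, ∑ r, (∑ i, ∑ j, ∑ k, C i j k * (P i l * P j m * P k r)) *
        (z l * z m * z r) := by
  have h : ∀ (c : Fin n → ℂ),
      ∑ i, c i * ∑ l, P i l * z l = ∑ l, (∑ i, c i * P i l) * z l := fun c ↦ by
    simp only [Finset.mul_sum, Finset.sum_mul]
    rw [Finset.sum_comm]
    simp only [mul_assoc]
  calc _ = ∑ i, (∑ j, (∑ k, C i j k * ∑ r, P k r * z r) * ∑ m, P j m * z m) *
        ∑ l, P i l * z l := by
        simp only [Finset.sum_mul]
        exact Finset.sum_congr rfl fun i _ ↦ Finset.sum_congr rfl fun j _ ↦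
          Finset.sum_congr rfl fun k _ ↦ by simp only [← Finset.sum_mul]; ring
    _ = ∑ l, (∑ i, (∑ m, (∑ j, (∑ r, (∑ k, C i j k * P k r) * z r) * P j m) * z m) * P i l) *
        z l := by
        simp only [h]
    _ = _ := by
        refine Finset.sum_congr rfl fun l _ ↦ ?_
        simp only [Finset.sum_mul]
        rw [Finset.sum_comm]
        refine Finset.sum_congr rfl fun m _ ↦ ?_
        rw [Finset.sum_comm_cycle]
        refine Finset.sum_congr rfl fun r _ ↦ ?_
        exact Finset.sum_congr rfl fun i _ ↦ Finset.sum_congr rfl fun j _ ↦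
          Finset.sum_congr rfl fun k _ ↦ by ring

/-- Coefficients expressing minus a cubic form, modulo `∑ xᵢ²`, through the derivatives of
`∑ λᵢ xᵢ²` along the rotation fields. -/
noncomputable def rotationCoeff {n : ℕ} (lam : Fin n → ℂ) (c : Fin n → Fin n → Fin n → ℂ) :
    Fin n → Fin n → Fin n → ℂ := fun i j k ↦
  -(c i j k + (if i = k then c i i j else 0) - (if j = k then c i i i else 0)) *
    (4 * (lam i - lam j))⁻¹

/-- The antisymmetric matrix with entries depending linearly on `z`, with coefficients `a`. -/
def antisymmMatrix {n : ℕ} (z : Fin n → ℂ) (a : Fin n → Fin n → Fin n → ℂ) :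
    Fin n → Fin n → ℂ := fun i j ↦ ∑ k, (a i j k - a j i k) * z k

theorem antisymmMatrix_swap {n : ℕ} (z : Fin n → ℂ) (a : Fin n → Fin n → Fin n → ℂ) (i j : Fin n) :
    antisymmMatrix z a i j = -antisymmMatrix z a j i := by
  simp only [antisymmMatrix, ← Finset.sum_neg_distrib]
  exact Finset.sum_congr rfl fun k _ ↦ by ring

/-- Exchanging `i` and `j` in the half containing `a j i k` produces the factor `lam i - lam j`,
which is where distinct eigenvalues become useful. -/
theorem sum_antisymmMatrix {n : ℕ} (lam z : Fin n → ℂ) (a : Fin n → Fin n → Fin n → ℂ) :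
    ∑ i, lam i * z i * ∑ j, antisymmMatrix z a i j * z j =
      ∑ i, ∑ j, (lam i - lam j) * (∑ k, a i j k * z k) * (z i * z j) := by
  have h1 : ∀ i j, antisymmMatrix z a i j = ∑ k, a i j k * z k - ∑ k, a j i k * z k :=
    fun i j ↦ by simp [antisymmMatrix, sub_mul]
  have h2 : ∑ i, ∑ j, lam i * (∑ k, a j i k * z k) * (z i * z j) =
      ∑ i, ∑ j, lam j * (∑ k, a i j k * z k) * (z i * z j) := by
    rw [Finset.sum_comm]
    exact Finset.sum_congr rfl fun i _ ↦ Finset.sum_congr rfl fun j _ ↦ by ring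
  calc _ = ∑ i, ∑ j, lam i * (∑ k, a i j k * z k) * (z i * z j) -
        ∑ i, ∑ j, lam i * (∑ k, a j i k * z k) * (z i * z j) := by
        simp only [h1]
        rw [← Finset.sum_sub_distrib]
        refine Finset.sum_congr rfl fun i _ ↦ ?_
        rw [Finset.mul_sum, ← Finset.sum_sub_distrib]
        exact Finset.sum_congr rfl fun j _ ↦ by ring
    _ = _ := by
        rw [h2]
        simp only [← Finset.sum_sub_distrib]
        exact Finset.sum_congr rfl fun i _ ↦ Finset.sum_congr rfl fun j _ ↦ by ring

/-- Monomials of the pair `(i, i)` lie out of reach. Those with `k ≠ i` are moved to the pair `(i,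
k)`, and `zᵢ³` is replaced by `zᵢ ∑ zⱼ² - ∑_{j ≠ i} zᵢ zⱼ²`: these are the two conditional terms of
`rotationCoeff`. For `i = j` the inverse of zero is harmless, being multiplied by `lam i - lam i`.
-/
theorem sum_rotationCoeff {n : ℕ} {lam : Fin n → ℂ} (hlam : Function.Injective lam)
    (c : Fin n → Fin n → Fin n → ℂ) (z : Fin n → ℂ) :
    4 * ∑ i, ∑ j, (lam i - lam j) * (∑ k, rotationCoeff lam c i j k * z k) * (z i * z j) =
      (∑ i, c i i i * z i) * ∑ j, z j ^ 2 - ∑ i, ∑ j, ∑ k, c i j k * (z i * z j * z k) := by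
  have h1 : ∀ i j, 4 * ((lam i - lam j) * (∑ k, rotationCoeff lam c i j k * z k) * (z i * z j)) =
      (if i = j then (∑ k, c i i k * z k) * (z i * z i) else 0) - c i i j * z i * (z i * z j)
        + c i i i * z j * (z i * z j) - ∑ k, c i j k * (z i * z j * z k) := by
    intro i j
    rcases eq_or_ne i j with rfl | hij
    · have : ∑ k, c i i k * (z i * z i * z k) = (∑ k, c i i k * z k) * (z i * z i) := by
        rw [Finset.sum_mul]
        exact Finset.sum_congr rfl fun k _ ↦ by ring
      rw [this]
      simp
    · have h0 : lam i - lam j ≠ 0 := sub_ne_zero.2 fun h ↦ hij (hlam h)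
      have h2 : ∑ k, rotationCoeff lam c i j k * z k =
          -(∑ k, c i j k * z k + c i i j * z i - c i i i * z j) * (4 * (lam i - lam j))⁻¹ := by
        have : ∀ k, rotationCoeff lam c i j k * z k =
            -(c i j k * z k + (if i = k then c i i j * z k else 0) -
              (if j = k then c i i i * z k else 0)) * (4 * (lam i - lam j))⁻¹ := fun k ↦ by
          simp only [rotationCoeff]
          split_ifs <;> ring
        simp only [this, ← Finset.sum_mul, Finset.sum_neg_distrib, Finset.sum_sub_distrib,
          Finset.sum_add_distrib, Finset.sum_ite_eq, Finset.mem_univ, if_true]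
      have h3 : ∑ k, c i j k * (z i * z j * z k) = (∑ k, c i j k * z k) * (z i * z j) := by
        rw [Finset.sum_mul]
        exact Finset.sum_congr rfl fun k _ ↦ by ring
      rw [h2, h3, if_neg hij]
      field_simp
      ring
  have h4 : ∑ i, (∑ k, c i i k * z k) * (z i * z i) = ∑ i, ∑ j, c i i j * z i * (z i * z j) := by
    refine Finset.sum_congr rfl fun i _ ↦ ?_
    rw [Finset.sum_mul]
    exact Finset.sum_congr rfl fun k _ ↦ by ring
  have h5 : (∑ i, c i i i * z i) * ∑ j, z j ^ 2 = ∑ i, ∑ j, c i i i * z j * (z i * z j) := by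
    rw [Finset.sum_mul_sum]
    exact Finset.sum_congr rfl fun i _ ↦ Finset.sum_congr rfl fun j _ ↦ by ring
  rw [Finset.mul_sum, Finset.sum_congr rfl fun i _ ↦ Finset.mul_sum _ _ _]
  simp only [h1, Finset.sum_sub_distrib, Finset.sum_add_distrib, Finset.sum_ite_eq, Finset.mem_univ,
    if_true]
  rw [h4, h5]
  ring

/-- The correction of a cubic form `N` by a multiple of the quadratic form `SᵀS`. -/
noncomputable def correctedCubic {n : ℕ} (S : Fin n → Fin n → ℂ) (N : Fin n → Fin n → Fin n → ℂ) :
    Fin n → Fin n → Fin n → ℂ := fun i j k ↦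
  N i j k - N i i i / (1 + ∑ l, S l i * S l i) * ∑ l, S l j * S l k

/-- The denominator is chosen so that the diagonal entry `C` solves `C = N i i i - C * ∑ l, S l i ^
2`. The multiplier of the correction is then the diagonal of the corrected form itself, which turns
reduction modulo `∑ zᵢ²` into reduction modulo `∑ (z + S z)ᵢ²`. -/
theorem correctedCubic_diag {n : ℕ} {S : Fin n → Fin n → ℂ} {i : Fin n}
    (hS : 1 + ∑ l, S l i * S l i ≠ 0) (N : Fin n → Fin n → Fin n → ℂ) :
    correctedCubic S N i i i = N i i i / (1 + ∑ l, S l i * S l i) := by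
  rw [correctedCubic, eq_div_iff hS, sub_mul, mul_right_comm, div_mul_cancel₀ _ hS]
  ring

theorem sum_correctedCubic {n : ℕ} {S : Fin n → Fin n → ℂ}
    (hS : ∀ i, 1 + ∑ l, S l i * S l i ≠ 0) (N : Fin n → Fin n → Fin n → ℂ) (z : Fin n → ℂ) :
    ∑ i, ∑ j, ∑ k, correctedCubic S N i j k * (z i * z j * z k) =
      ∑ i, ∑ j, ∑ k, N i j k * (z i * z j * z k) -
        (∑ i, correctedCubic S N i i i * z i) *
          ∑ j, ∑ k, (∑ l, S l j * S l k) * (z j * z k) := by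
  simp only [fun i ↦ correctedCubic_diag (hS i) N]
  rw [Finset.sum_mul, ← Finset.sum_sub_distrib]
  refine Finset.sum_congr rfl fun i _ ↦ ?_
  rw [Finset.mul_sum, ← Finset.sum_sub_distrib]
  refine Finset.sum_congr rfl fun j _ ↦ ?_
  rw [Finset.mul_sum, ← Finset.sum_sub_distrib]
  refine Finset.sum_congr rfl fun k _ ↦ ?_
  simp only [correctedCubic]
  ring

/-- If `S` is built from the rotation coefficients of the corrected form of `N`, then the form
`N` cancels the variation of `∑ λᵢ xᵢ²` modulo `∑ xᵢ²`. -/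
theorem sum_sq_sub_add_cubic_eq {n : ℕ} {lam : Fin n → ℂ} (hlam : Function.Injective lam)
    {S : Fin n → Fin n → ℂ} {N : Fin n → Fin n → Fin n → ℂ} {z : Fin n → ℂ}
    (hS : ∀ i, 1 + ∑ l, S l i * S l i ≠ 0)
    (hSN : S = antisymmMatrix z (rotationCoeff lam (correctedCubic S N))) :
    ∑ i, lam i * (z i + ∑ j, S i j * z j) ^ 2 - ∑ i, lam i * (z i - ∑ j, S i j * z j) ^ 2 +
      ∑ i, ∑ j, ∑ k, N i j k * (z i * z j * z k) =
      (∑ i, correctedCubic S N i i i * z i) * ∑ i, (z i + ∑ j, S i j * z j) ^ 2 := by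
  have hanti : ∀ i j, S i j = -S j i := fun i j ↦ by
    rw [hSN]
    exact antisymmMatrix_swap _ _ _ _
  -- The symmetric choice `z ± S z` leaves no term quadratic in `S`.
  have h1 : ∑ i, lam i * (z i + ∑ j, S i j * z j) ^ 2 -
      ∑ i, lam i * (z i - ∑ j, S i j * z j) ^ 2 = 4 * ∑ i, lam i * z i * ∑ j, S i j * z j := by
    rw [← Finset.sum_sub_distrib, Finset.mul_sum]
    exact Finset.sum_congr rfl fun i _ ↦ by ring
  have h2 : 4 * ∑ i, lam i * z i * ∑ j, S i j * z j =
      (∑ i, correctedCubic S N i i i * z i) * ∑ j, z j ^ 2 -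
        ∑ i, ∑ j, ∑ k, correctedCubic S N i j k * (z i * z j * z k) := by
    rw [← sum_rotationCoeff hlam, ← sum_antisymmMatrix, ← hSN]
  rw [h1, h2, sum_correctedCubic hS, sum_sq_add_antisymm hanti]
  ring

/-- The coefficients, in terms of `z`, of the value of a cubic form at `z + S z`. -/
noncomputable def pullbackCubic {n : ℕ} (c : Fin n → Fin n → Fin n → (Fin n → ℂ) → ℂ)
    (u : (Fin n → ℂ) × (Fin n → Fin n → ℂ)) : Fin n → Fin n → Fin n → ℂ := fun l m r ↦
  ∑ i, ∑ j, ∑ k, c i j k (fun i ↦ u.1 i + ∑ j, u.2 i j * u.1 j) *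
    (((if i = l then 1 else 0) + u.2 i l) * ((if j = m then 1 else 0) + u.2 j m) *
      ((if k = r then 1 else 0) + u.2 k r))

theorem sum_pullbackCubic {n : ℕ} (c : Fin n → Fin n → Fin n → (Fin n → ℂ) → ℂ)
    (z : Fin n → ℂ) (S : Fin n → Fin n → ℂ) :
    ∑ i, ∑ j, ∑ k, c i j k (fun i ↦ z i + ∑ j, S i j * z j) *
      ((z i + ∑ l, S i l * z l) * (z j + ∑ l, S j l * z l) * (z k + ∑ l, S k l * z l)) =
    ∑ i, ∑ j, ∑ k, pullbackCubic c (z, S) i j k * (z i * z j * z k) := by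
  have h : ∀ i, z i + ∑ l, S i l * z l = ∑ l, ((if i = l then 1 else 0) + S i l) * z l :=
    fun i ↦ by simp [add_mul, Finset.sum_add_distrib]
  have h2 := sum_cubic_substitution (fun i j k ↦ c i j k (fun i ↦ z i + ∑ j, S i j * z j))
    (fun i l ↦ (if i = l then 1 else 0) + S i l) z
  simp only [← h] at h2
  exact h2

theorem contDiffAt_pullbackCubic {n : ℕ} {c : Fin n → Fin n → Fin n → (Fin n → ℂ) → ℂ}
    (hc : ∀ i j k, ContDiffAt ℂ ω (c i j k) 0) : ContDiffAt ℂ ω (pullbackCubic c) (0, 0) := by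
  refine contDiffAt_pi.2 fun l ↦ contDiffAt_pi.2 fun m ↦ contDiffAt_pi.2 fun r ↦ ?_
  refine ContDiffAt.sum fun i _ ↦ ContDiffAt.sum fun j _ ↦ ContDiffAt.sum fun k _ ↦
    ContDiffAt.mul ?_ (by fun_prop)
  refine ContDiffAt.comp (g := c i j k)
    (f := fun u : (Fin n → ℂ) × (Fin n → Fin n → ℂ) ↦ fun i ↦ u.1 i + ∑ j, u.2 i j * u.1 j)
    (0, 0) ?_ (by fun_prop)
  have h0 : (fun i ↦ (0 : Fin n → ℂ) i + ∑ j, (0 : Fin n → Fin n → ℂ) i j * (0 : Fin n → ℂ) j)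
      = 0 := by
    ext i
    simp
  change ContDiffAt ℂ ω (c i j k) (fun i ↦ (0 : Fin n → ℂ) i +
    ∑ j, (0 : Fin n → Fin n → ℂ) i j * (0 : Fin n → ℂ) j)
  rw [h0]
  exact hc i j k

/-! ### Construction of the diffeomorphism -/

/-- Two germs with the same diagonal quadratic part with distinct eigenvalues coincide, up to a
diffeomorphism preserving `∑ xᵢ²`, in restriction to `∑ xᵢ² = 0`. -/
theorem exists_isDiffeoGerm_preserving_sum_sq {n : ℕ} {lam : Fin n → ℂ}
    (hlam : Function.Injective lam) {G₀ G₁ : (Fin n → ℂ) → ℂ}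
    {c₀ c₁ : Fin n → Fin n → Fin n → (Fin n → ℂ) → ℂ}
    (hc₀ : ∀ i j k, ContDiffAt ℂ ω (c₀ i j k) 0) (hc₁ : ∀ i j k, ContDiffAt ℂ ω (c₁ i j k) 0)
    (hG₀ : ∀ᶠ x in 𝓝 0,
      G₀ x = ∑ i, lam i * x i ^ 2 + ∑ i, ∑ j, ∑ k, c₀ i j k x * (x i * x j * x k))
    (hG₁ : ∀ᶠ x in 𝓝 0,
      G₁ x = ∑ i, lam i * x i ^ 2 + ∑ i, ∑ j, ∑ k, c₁ i j k x * (x i * x j * x k)) :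
    ∃ φ, IsDiffeoGerm φ ∧ (∀ᶠ x in 𝓝 0, ∑ i, φ x i ^ 2 = ∑ i, x i ^ 2) ∧
      ∀ᶠ x in 𝓝 0, ∑ i, x i ^ 2 = 0 → G₀ (φ x) = G₁ x := by
  -- The cubic part of `G₀` at `z + S z` minus that of `G₁` at `z - S z`.
  let N : (Fin n → ℂ) × (Fin n → Fin n → ℂ) → Fin n → Fin n → Fin n → ℂ := fun u ↦
    pullbackCubic c₀ u - pullbackCubic c₁ (u.1, -u.2)
  have hN : ContDiffAt ℂ ω N (0, 0) := by
    refine (contDiffAt_pullbackCubic hc₀).sub (ContDiffAt.comp (g := pullbackCubic c₁)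
      (f := fun u : (Fin n → ℂ) × (Fin n → Fin n → ℂ) ↦ (u.1, -u.2)) (0, 0) ?_
      (contDiffAt_fst.prodMk contDiffAt_snd.neg))
    simpa using contDiffAt_pullbackCubic hc₁
  let Θ : (Fin n → ℂ) × (Fin n → Fin n → ℂ) → Fin n → Fin n → Fin n → ℂ := fun u ↦
    rotationCoeff lam (correctedCubic u.2 (N u))
  have hΘ : ContDiffAt ℂ ω Θ (0, 0) := by
    have hN' : ∀ i j k, ContDiffAt ℂ ω (fun u ↦ N u i j k) (0, 0) := fun i j k ↦
      contDiffAt_pi.1 (contDiffAt_pi.1 (contDiffAt_pi.1 hN i) j) k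
    have hcor : ∀ i j k, ContDiffAt ℂ ω (fun u : (Fin n → ℂ) × (Fin n → Fin n → ℂ) ↦
        correctedCubic u.2 (N u) i j k) (0, 0) := fun i j k ↦ by
      refine (hN' i j k).sub (ContDiffAt.mul (ContDiffAt.div (hN' i i i) (by fun_prop) ?_)
        (by fun_prop))
      simp
    refine contDiffAt_pi.2 fun i ↦ contDiffAt_pi.2 fun j ↦ contDiffAt_pi.2 fun k ↦ ?_
    simp only [Θ, rotationCoeff]
    refine ContDiffAt.mul (ContDiffAt.neg (ContDiffAt.sub (ContDiffAt.add (hcor i j k) ?_) ?_))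
      contDiffAt_const
    · split_ifs
      exacts [hcor i i j, contDiffAt_const]
    · split_ifs
      exacts [hcor i i i, contDiffAt_const]
  have hanti0 : ∀ a : Fin n → Fin n → Fin n → ℂ, antisymmMatrix 0 a = 0 := fun a ↦ by
    ext i j
    simp [antisymmMatrix]
  -- The unknown is the coefficient array `a`, not `S`: since `antisymmMatrix 0 a = 0`, the right
  -- side at `z = 0` is the constant `Θ (0, 0)`.
  obtain ⟨a, ha, -, haΘ⟩ := ContDiffAt.exists_fixedPoint (a₀ := Θ (0, 0))
    (Ψ := fun u : (Fin n → ℂ) × (Fin n → Fin n → Fin n → ℂ) ↦ Θ (u.1, antisymmMatrix u.1 u.2))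
    (by
      refine ContDiffAt.comp (g := Θ) _ (by simpa [hanti0] using hΘ) ?_
      refine contDiffAt_fst.prodMk (contDiffAt_pi.2 fun i ↦ contDiffAt_pi.2 fun j ↦ ?_)
      simp only [antisymmMatrix]
      fun_prop)
    (by simp [hanti0]) (by simpa only [hanti0] using hasFDerivAt_const _ _)
  let S : (Fin n → ℂ) → Fin n → Fin n → ℂ := fun z ↦ antisymmMatrix z (a z)
  have hS : ContDiffAt ℂ ω S 0 := by
    have ha' : ∀ i j k, ContDiffAt ℂ ω (fun z ↦ a z i j k) 0 := fun i j k ↦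
      contDiffAt_pi.1 (contDiffAt_pi.1 (contDiffAt_pi.1 ha i) j) k
    refine contDiffAt_pi.2 fun i ↦ contDiffAt_pi.2 fun j ↦ ContDiffAt.sum fun k _ ↦ ?_
    exact ((ha' i j k).sub (ha' j i k)).mul (by fun_prop)
  have hS0 : S 0 = 0 := hanti0 _
  have hanti : ∀ z i j, S z i j = -S z j i := fun z ↦ antisymmMatrix_swap z (a z)
  obtain ⟨v, hv, -, hv1, -⟩ := hS.isDiffeoGerm_add_mul hS0
  obtain ⟨w, hw, -, -, hw2⟩ := hS.neg.isDiffeoGerm_add_mul (by simp [hS0])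
  -- `p` is the germ of `z ↦ z + S z • z` and `w` inverts `z ↦ z - S z • z`, so `p ∘ w` is the
  -- Cayley transform.
  obtain ⟨p, hp, hp1, -⟩ := hv.exists_symm
  have hne : ∀ᶠ z in 𝓝 0, ∀ i, 1 + ∑ l, S z l i * S z l i ≠ 0 := by
    refine eventually_all.2 fun i ↦ ContinuousAt.eventually_ne ?_ (by simp [hS0])
    have hS' : ∀ i j, ContinuousAt (fun z ↦ S z i j) 0 := fun i j ↦
      (contDiffAt_pi.1 (contDiffAt_pi.1 hS i) j).continuousAt
    exact continuousAt_const.add (tendsto_finsetSum _ fun l _ ↦ (hS' l i).mul (hS' l i))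
  have hplus : ContinuousAt (fun z : Fin n → ℂ ↦ fun i ↦ z i + ∑ j, S z i j * z j) 0 := by
    refine continuousAt_pi.2 fun i ↦ (continuous_apply i).continuousAt.add
      (tendsto_finsetSum _ fun j _ ↦ ?_)
    exact (contDiffAt_pi.1 (contDiffAt_pi.1 hS i) j).continuousAt.mul
      (continuous_apply j).continuousAt
  have hplus' : Tendsto (fun z : Fin n → ℂ ↦ fun i ↦ z i + ∑ j, S z i j * z j) (𝓝 0) (𝓝 0) := by
    have h0 : (fun i ↦ (0 : Fin n → ℂ) i + ∑ j, S 0 i j * (0 : Fin n → ℂ) j) = 0 := by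
      ext i
      simp
    have h1 := hplus.tendsto
    rwa [h0] at h1
  have hφ : ∀ᶠ x in 𝓝 0, (p ∘ w) x = fun i ↦ w x i + ∑ j, S (w x) i j * w x j := by
    filter_upwards [hw.tendsto.eventually hv1,
      (hplus'.comp hw.tendsto).eventually hp1] with x h1 h2
    simp only [Function.comp_apply] at h2 ⊢
    rwa [h1] at h2
  have hminus : ∀ᶠ x in 𝓝 0, x = fun i ↦ w x i - ∑ j, S (w x) i j * w x j := by
    filter_upwards [hw2] with x hx
    conv_lhs => rw [← hx]
    ext i
    simp [sub_eq_add_neg]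
  have hsq : ∀ z, ∑ i, (z i - ∑ j, S z i j * z j) ^ 2 = ∑ i, (z i + ∑ j, S z i j * z j) ^ 2 := by
    intro z
    rw [sum_sq_add_antisymm (hanti z)]
    have := sum_sq_add_antisymm (S := -S z) (fun i j ↦ by simp [← hanti z j i]) z
    simpa [sub_eq_add_neg] using this
  refine ⟨p ∘ w, hp.comp hw, ?_, ?_⟩
  · filter_upwards [hφ, hminus] with x h1 h2
    rw [h1, ← hsq]
    exact Finset.sum_congr rfl fun i _ ↦ congrArg (· ^ 2) (congrFun h2 i).symm
  · filter_upwards [hφ, hminus, hw.tendsto.eventually haΘ, hw.tendsto.eventually hne,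
      (hplus'.comp hw.tendsto).eventually hG₀, hG₁] with x h1 h2 h3 h4 h5 h6 h7
    rw [h1]
    simp only [Function.comp_apply] at h5
    rw [h5, h6]
    have h8 : S (w x) = antisymmMatrix (w x)
        (rotationCoeff lam (correctedCubic (S (w x)) (N (w x, S (w x))))) := by
      conv_lhs => simp only [S]
      rw [h3]
    have h9 := sum_sq_sub_add_cubic_eq hlam h4 h8
    have h10 : ∑ i, (w x i + ∑ j, S (w x) i j * w x j) ^ 2 = 0 := by
      rw [← hsq, ← h7]
      exact Finset.sum_congr rfl fun i _ ↦ congrArg (· ^ 2) (congrFun h2 i).symm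
    rw [h10, mul_zero] at h9
    have h11 := sum_pullbackCubic c₁ (w x) (-S (w x))
    simp only [Pi.neg_apply, neg_mul, Finset.sum_neg_distrib, ← sub_eq_add_neg, ← h2] at h11
    have h12 : ∀ i, w x i - ∑ j, S (w x) i j * w x j = x i := fun i ↦ (congrFun h2 i).symm
    simp only [h12] at h9 h11
    rw [sum_pullbackCubic, h11]
    simp only [N, Pi.sub_apply, sub_mul, Finset.sum_sub_distrib] at h9
    linear_combination h9

/-! ### The theorem and its corollary -/

theorem mainTheorem7 (n : ℕ) (f : (Fin n → ℂ) → ℂ) (hf : IsMorse f) :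
    (∀ g₀ g₁ : (Fin n → ℂ) → ℂ, IsMorse g₀ → IsMorse g₁ →
      IsRGeneric f g₀ → IsRGeneric f g₁ → SameJet 2 g₀ g₁ →
      ∃ φ : (Fin n → ℂ) → (Fin n → ℂ), IsDiffeoGerm φ ∧
        (∀ᶠ x in 𝓝 0, f (φ x) = f x) ∧
        (∀ᶠ x in 𝓝 0, f x = 0 → g₀ (φ x) = g₁ x)) ∧
    (∀ g : (Fin n → ℂ) → ℂ, IsMorse g → IsRGeneric f g →
      ∃ (ψ : (Fin n → ℂ) → (Fin n → ℂ)) (lam : Fin (n - 1) → ℂ), IsDiffeoGerm ψ ∧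
        (∀ᶠ x in 𝓝 0, f (ψ x) = ∑ i, x i ^ 2) ∧
        (∀ᶠ x in 𝓝 0, ∑ i, x i ^ 2 = 0 →
          g (ψ x) = ∑ i : Fin (n - 1), lam i * x (Fin.castLE (Nat.sub_le n 1) i) ^ 2)) := by
  refine ⟨fun g₀ g₁ hg₀ hg₁ ⟨L, lam, hlam, hLf, hLg₀⟩ _ hjet ↦ ?_,
    fun g hg ⟨L, lam, hlam, hLf, hLg⟩ ↦ ?_⟩
  · have hLg₁ : ∀ x, quadraticPart g₁ (L x) = ∑ i, lam i * x i ^ 2 := fun x ↦ by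
      rw [← hLg₀, quadraticPart, quadraticPart, hjet 2 le_rfl]
    obtain ⟨ψ, hψ, hψL, hfψ⟩ := hf.exists_morse_coordinates L hLf
    obtain ⟨c₀, hc₀, hgc₀⟩ := hg₀.exists_comp_eq_quadraticPart_add_cubic hψ.1 hψ.2.1 hψL
    obtain ⟨c₁, hc₁, hgc₁⟩ := hg₁.exists_comp_eq_quadraticPart_add_cubic hψ.1 hψ.2.1 hψL
    simp only [ContinuousLinearEquiv.coe_coe, LinearEquiv.coe_toContinuousLinearEquiv', hLg₀,
      hLg₁] at hgc₀ hgc₁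
    obtain ⟨φ, hφ, hφf, hφg⟩ := exists_isDiffeoGerm_preserving_sum_sq (G₀ := g₀ ∘ ψ)
      (G₁ := g₁ ∘ ψ) hlam hc₀ hc₁ hgc₀ hgc₁
    obtain ⟨χ, hχ, -, hψχ⟩ := hψ.exists_symm
    refine ⟨ψ ∘ φ ∘ χ, hψ.comp (hφ.comp hχ), ?_, ?_⟩
    · filter_upwards [hψχ, hχ.tendsto.eventually hfψ,
        (hφ.tendsto.comp hχ.tendsto).eventually hfψ, hχ.tendsto.eventually hφf] with x h1 h2 h3 h4
      simp only [Function.comp_apply] at h3 ⊢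
      rw [h3, h4, ← h2, h1]
    · filter_upwards [hψχ, hχ.tendsto.eventually hfψ, hχ.tendsto.eventually hφg] with x h1 h2 h3 hx
      have h4 := h3 (by rw [← h2, h1, hx])
      simpa [h1] using h4
  · obtain ⟨ψ, hψ, hψL, hfψ⟩ := hf.exists_morse_coordinates L hLf
    obtain ⟨c, hc, hgc⟩ := hg.exists_comp_eq_quadraticPart_add_cubic hψ.1 hψ.2.1 hψL
    simp only [ContinuousLinearEquiv.coe_coe, LinearEquiv.coe_toContinuousLinearEquiv', hLg]
      at hgc
    obtain ⟨φ, hφ, hφf, hφg⟩ := exists_isDiffeoGerm_preserving_sum_sq (G₀ := g ∘ ψ)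
      (G₁ := fun x ↦ ∑ i, lam i * x i ^ 2) (c₁ := fun _ _ _ _ ↦ 0) hlam hc
      (fun _ _ _ ↦ contDiffAt_const) hgc (by simp)
    refine ⟨ψ ∘ φ, ?_⟩
    have hfφ : ∀ᶠ x in 𝓝 0, f ((ψ ∘ φ) x) = ∑ i, x i ^ 2 := by
      filter_upwards [hφ.tendsto.eventually hfψ, hφf] with x h1 h2
      rw [Function.comp_apply, h1, h2]
    rcases n with _ | m
    -- For `n = 0` truncated subtraction makes `Fin (n - 1)` empty, and both sums are zero.
    · refine ⟨Fin.elim0, hψ.comp hφ, hfφ, ?_⟩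
      filter_upwards [hφg] with x hx h0
      simpa using hx h0
    -- On the cone the last square is minus the sum of the others, so its eigenvalue is subtracted
    -- from each of theirs.
    · refine ⟨fun i ↦ lam (Fin.castSucc i) - lam (Fin.last m), hψ.comp hφ, hfφ, ?_⟩
      filter_upwards [hφg] with x hx h0
      have h1 := hx h0
      simp only [Function.comp_apply] at h1 ⊢
      rw [h1]
      rw [Fin.sum_univ_castSucc] at h0 ⊢
      have h2 : x (Fin.last m) ^ 2 = -∑ i : Fin m, x i.castSucc ^ 2 := by linear_combination h0
      rw [h2, mul_neg, Finset.mul_sum, ← sub_eq_add_neg, ← Finset.sum_sub_distrib]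
      exact Finset.sum_congr rfl fun i _ ↦ (sub_mul _ _ _).symm
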